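/- Let $n\ge 1$ and write $[n]=\{1,\dots,n\}$. A Hessenberg function on $[n]$ is a function $h:[n]\to[n]$ with $h(i)\ge i$ for all $i$ and $h(i+1)\ge h(i)$ for $1\le i<n$. For $1\le j\le i\le n$ define in $\mathcal R=\mathbb Q[x_1,\dots,x_n]$ $$f_{i,j}=\sum_{k=1}^{j}\Big(\prod_{\ell=j+1}^{i}(x_k-x_\ell)\Big)x_k,\qquad g_{i,j}=\sum_{k=1}^{j}\ \prod_{\ell=j+1}^{i}(x_k-x_\ell)$$ (empty products are $1$), let $I_h=\langle f_{h(1),1},\dots,f_{h(n),n}\rangle$, and for $1\le s\le n+1$ let $$\mathcal A_s^h=\mathcal R/\langle g_{h(1),1},\dots,g_{h(s-1),s-1},f_{h(s),s},\dots,f_{h(n),n}\rangle ,$$ so that $\mathcal A_1^h=\mathcal R/I_h$. Let $\mathsf p(h)=\min\{m\in[n] : h(m)=m\}$ and, for $1\le s\le n$, let $r_s=\min\{m : h(m)\ge s\}$, and let $h^{(s)}$ be the Hessenberg function on $[n-1]$ given by $$h^{(s)}(m)=\begin{cases}h(m)&1\le m\le r_s-1,\\ h(m)-1&r_s\le m\le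 s-1,\\ h(m+1)-1&s\le m\le n-1.\end{cases}$$ (For $n=1$, $h^{(1)}$ is the empty function and $\mathcal A_1^{h^{(1)}}=\mathbb Q$.) Then for every Hessenberg function $h$ on $[n]$ the following hold. (1) For each $1\le s\le \mathsf p(h)$, multiplication by $x_s$, $[f]\mapsto[x_sf]$, is a well-defined injective linear map ($\mathbb Q$-linear, and indeed $\mathcal R$-linear) $\mathcal A_{s+1}^h\to\mathcal A_s^h$. Composing these maps embeds each $\mathcal A_s^h$, $1\le s\le\mathsf p(h)$, into $\mathcal A_1^h=\mathcal R/I_h$, and the images form a descending filtration $$\mathcal R/I_h=\mathcal A_1^h\supseteq\mathcal A_2^h\supseteq\cdots\supseteq\mathcal A_{\mathsf p(h)}^h\supseteq \mathcal A_{\mathsf p(h)+1}^h=0 .$$ (2) For each $1\le s\le\mathsf p(h)$ the image of $\mathcal A_{s+1}^h$ in $\mathcal A_s^h$ under multiplication by $x_s$ is the ideal $\langle x_s\rangle$, and there is an isomorphism of $\mathbb Q$-algebras $$\mathcal A_s^h/\mathcal A_{s+1}^h=\mathcal A_s^h/\langle x_s\rangle\;\cong\;\mathcal A_{r_s}^{h^{(s)}}$$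 which, writing $y_1,\dots,y_{n-1}$ for the variables of the right-hand ring, sends $x_m\mapsto y_m$ for $1\le m\le s-1$, $x_s\mapsto 0$, and $x_m\mapsto y_{m-1}$ for $s+1\le m\le n$. (3) In particular, for $s=\mathsf p(h)$ the same assignment of the variables gives an isomorphism of $\mathbb Q$-algebras $\mathcal A_{\mathsf p(h)}^h\cong\mathcal A_{r_{\mathsf p(h)}}^{h^{(\mathsf p(h))}}$. -/

import Mathlib

/-! Indices are counted from `0`: an element `i : Fin n` stands for the integer `i + 1` of
`[n] = {1, …, n}`, and `X i` is the variable `x_{i+1}`. -/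

/-- A Hessenberg function on `[n]`: a weakly increasing `h : [n] → [n]` with `h i ≥ i`. -/
structure HessenbergFunction (n : ℕ) where
  toFun : Fin n → Fin n
  le_toFun : ∀ i, i ≤ toFun i
  monotone_toFun : Monotone toFun

namespace HessenbergFunction

/-- `f_{i,j} = ∑_{k ≤ j} (∏_{j < ℓ ≤ i} (x_k - x_ℓ)) x_k`. -/
noncomputable def fPoly {n : ℕ} (i j : Fin n) : MvPolynomial (Fin n) ℚ :=
  ∑ k ∈ Finset.Iic j,
    (∏ l ∈ Finset.Ioc j i, (MvPolynomial.X k - MvPolynomial.X l)) * MvPolynomial.X k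

/-- `g_{i,j} = ∑_{k ≤ j} ∏_{j < ℓ ≤ i} (x_k - x_ℓ)`. -/
noncomputable def gPoly {n : ℕ} (i j : Fin n) : MvPolynomial (Fin n) ℚ :=
  ∑ k ∈ Finset.Iic j, ∏ l ∈ Finset.Ioc j i, (MvPolynomial.X k - MvPolynomial.X l)

/-- `I_h = ⟨f_{h(1),1}, …, f_{h(n),n}⟩`. -/
noncomputable def idealI {n : ℕ} (h : HessenbergFunction n) : Ideal (MvPolynomial (Fin n) ℚ) :=
  Ideal.span (Set.range fun m : Fin n => fPoly (h.toFun m) m)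

/-- The ideal whose generator at position `m` is `g_{h(m),m}` if `m < s` and `f_{h(m),m}` if
`m ≥ s`. -/
noncomputable def idealA {n : ℕ} (h : HessenbergFunction n) (s : ℕ) :
    Ideal (MvPolynomial (Fin n) ℚ) :=
  Ideal.span (Set.range fun m : Fin n =>
    if (m : ℕ) < s then gPoly (h.toFun m) m else fPoly (h.toFun m) m)

/-- The ring `ℚ[x_1, …, x_n] / ⟨g at the positions m < s, f at the positions m ≥ s⟩`. As positions
are counted from `0`, `h.A s` is the ring usually written `𝒜_{s+1}^h`; thus `h.A 0` is `𝒜_1^h`. -/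
abbrev A {n : ℕ} (h : HessenbergFunction n) (s : ℕ) : Type :=
  MvPolynomial (Fin n) ℚ ⧸ h.idealA s

/-- The class in `h.A s` of a polynomial. -/
noncomputable abbrev mkA {n : ℕ} (h : HessenbergFunction n) (s : ℕ) :
    MvPolynomial (Fin n) ℚ →+* h.A s :=
  Ideal.Quotient.mk (h.idealA s)

/-- `r_s = min {m | h(m) ≥ s}`. -/
def r {n : ℕ} (h : HessenbergFunction n) (s : Fin n) : Fin n :=
  (Finset.univ.filter fun m : Fin n => s ≤ h.toFun m).min'
    ⟨s, Finset.mem_filter.2 ⟨Finset.mem_univ _, h.le_toFun s⟩⟩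

/-- `p(h) = min {m | h(m) = m}`. -/
def p {n : ℕ} (h : HessenbergFunction (n + 1)) : Fin (n + 1) :=
  (Finset.univ.filter fun m : Fin (n + 1) => h.toFun m = m).min'
    ⟨Fin.last n, Finset.mem_filter.2
      ⟨Finset.mem_univ _, le_antisymm (Fin.le_last _) (h.le_toFun _)⟩⟩

theorem le_of_r_le {n : ℕ} (h : HessenbergFunction n) (s m : Fin n) (hm : h.r s ≤ m) :
    s ≤ h.toFun m :=
  le_trans (Finset.mem_filter.1 (Finset.min'_mem
    (Finset.univ.filter fun m : Fin n => s ≤ h.toFun m) _)).2 (h.monotone_toFun hm)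

theorem lt_of_lt_r {n : ℕ} (h : HessenbergFunction n) (s m : Fin n) (hm : m < h.r s) :
    h.toFun m < s := by
  by_contra hc
  have hmem : m ∈ Finset.univ.filter fun m : Fin n => s ≤ h.toFun m :=
    Finset.mem_filter.2 ⟨Finset.mem_univ _, not_lt.1 hc⟩
  exact absurd hm (not_lt.2 (Finset.min'_le _ m hmem))

/-- The values of `h^{(s)}` as natural numbers. -/
def removeVal {n : ℕ} (h : HessenbergFunction (n + 1)) (s : Fin (n + 1)) (m : Fin n) : ℕ :=
  if (m : ℕ) < (h.r s : ℕ) then (h.toFun m.castSucc : ℕ)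
  else if (m : ℕ) < (s : ℕ) then (h.toFun m.castSucc : ℕ) - 1
  else (h.toFun m.succ : ℕ) - 1

theorem removeVal_lt {n : ℕ} (h : HessenbergFunction (n + 1)) (s : Fin (n + 1)) (m : Fin n) :
    h.removeVal s m < n := by
  have h1 := (h.toFun m.castSucc).isLt
  have h2 := (h.toFun m.succ).isLt
  have h3 := m.isLt
  have h4 := s.isLt
  unfold removeVal
  split_ifs with ha hb
  · have := h.lt_of_lt_r s m.castSucc (Fin.lt_def.2 (by simpa using ha))
    rw [Fin.lt_def] at this
    omega
  · omega
  · omega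

theorem le_removeVal {n : ℕ} (h : HessenbergFunction (n + 1)) (s : Fin (n + 1)) (m : Fin n) :
    (m : ℕ) ≤ h.removeVal s m := by
  have h1 := Fin.le_def.1 (h.le_toFun m.castSucc)
  have h2 := Fin.le_def.1 (h.le_toFun m.succ)
  simp only [Fin.val_castSucc, Fin.val_succ] at h1 h2
  unfold removeVal
  split_ifs with ha hb
  · exact h1
  · have := h.le_of_r_le s m.castSucc (Fin.le_def.2 (by simpa using not_lt.1 ha))
    rw [Fin.le_def] at this
    omega
  · omega

theorem removeVal_mono {n : ℕ} (h : HessenbergFunction (n + 1)) (s : Fin (n + 1))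
    {a b : Fin n} (hab : a ≤ b) : h.removeVal s a ≤ h.removeVal s b := by
  have hab' := Fin.le_def.1 hab
  have h1 := Fin.le_def.1 (h.monotone_toFun (Fin.castSucc_le_castSucc_iff.2 hab))
  have h2 := Fin.le_def.1 (h.monotone_toFun (Fin.succ_le_succ_iff.2 hab))
  have h3 := Fin.le_def.1 (h.monotone_toFun (Fin.castSucc_lt_succ (i := b)).le)
  have h4 : (a : ℕ) < (h.r s : ℕ) → (h.toFun a.castSucc : ℕ) < s := fun hh =>
    Fin.lt_def.1 (h.lt_of_lt_r s a.castSucc (Fin.lt_def.2 (by simpa using hh)))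
  have h5 : ¬ (b : ℕ) < (h.r s : ℕ) → (s : ℕ) ≤ h.toFun b.castSucc := fun hh =>
    Fin.le_def.1 (h.le_of_r_le s b.castSucc (Fin.le_def.2 (by simpa using not_lt.1 hh)))
  unfold removeVal
  split_ifs <;> omega

/-- The Hessenberg function `h^{(s)}` on `[n - 1]`, obtained by deleting the `s`-th row and column
of the diagram of `h`: its value at `m` is `h(m)` for `m < r_s`, `h(m) - 1` for `r_s ≤ m < s`, and
`h(m + 1) - 1` for `m ≥ s`. -/
def remove {n : ℕ} (h : HessenbergFunction (n + 1)) (s : Fin (n + 1)) : HessenbergFunction n where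
  toFun m := ⟨h.removeVal s m, h.removeVal_lt s m⟩
  le_toFun m := Fin.le_def.2 (h.le_removeVal s m)
  monotone_toFun _ _ hab := Fin.le_def.2 (h.removeVal_mono s hab)

/-- The composite `h.A s → h.A (s - 1) → ⋯ → h.A 0` of a chain of linear maps. -/
noncomputable def chain {n : ℕ} (h : HessenbergFunction n)
    (μ : ∀ s : ℕ, h.A (s + 1) →ₗ[MvPolynomial (Fin n) ℚ] h.A s) :
    ∀ s : ℕ, h.A s →ₗ[MvPolynomial (Fin n) ℚ] h.A 0
  | 0 => LinearMap.id
  | s + 1 => (chain h μ s).comp (μ s)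

end HessenbergFunction

/-! In this comment indices start from `1`, as in the usual notation `𝒜_s^h`, which is `h.A (s - 1)`.

The multiplication by `x_s` is well defined because of the recursions
`f_{b,s} = x_s g_{b,s} + g_{b,s-1}` and `g_{b+1,j} = f_{b,j} - x_{b+1} g_{b,j}`: they show that
`g_{h(s),s-1}` lies in the ideal of the `g_{h(m),m}` with `m < s` (`diffSum_mem`), so that modulo this
ideal `f_{h(s),s}` is `x_s g_{h(s),s}` (`fPoly_sub_mem`). Setting `x_s = 0` turns the generators at
the positions `m ≠ s` into those for `h^{(s)}` and `r_s` (`killVar_gen`) and kills the generator at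
position `s` modulo the others, which gives the quotients (`exists_quotient_equiv`).

The injectivity says that `x_s` is a nonzerodivisor modulo the generators `θ` at the positions
`m ≠ s`. It is proved without gradings or dimension counts, from the vanishing of the first Koszul
homology: the syzygies of the generators are all trivial (`HasKoszulSyzygies`). This property does
not depend on the order of the family and it has the following permanence properties.
* If it holds for `θ` modulo a nonzerodivisor `x`, it holds for `θ` with `x` adjoined
  (`HasKoszulSyzygiesWith.of_surjective`).
* If it holds for `θ` with `x` adjoined and for `θ` with `y` adjoined, it holds for `θ` with `x y`
  adjoined (`HasKoszulSyzygiesWith.mul`), or with `x y` plus an element of the ideal of `θ`.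
* It holds as soon as the family contains a unit (`HasKoszulSyzygiesWith.of_isUnit`).
* If it holds for `θ` with `x` adjoined, `x` is a nonzerodivisor modulo `θ`
  (`HasKoszulSyzygiesWith.mem_span`).

So the property for the generators of `𝒜_s^h` follows, as `f_{h(s),s}` is `x_s g_{h(s),s}` modulo the
others, from that of `𝒜_{s+1}^h` and that of `𝒜_{r_s}^{h^{(s)}}` in one variable less. The induction
on `s` descends from `s = p(h) + 1`, where `g_{p(h),p(h)} = p(h)` is a unit
(`hasKoszulSyzygies_gen`). -/

/-! ### Families all of whose syzygies are Koszul -/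

/-- Every syzygy `∑ aᵢ θᵢ = 0` is a combination of the trivial ones `θⱼ eᵢ - θᵢ eⱼ`; that is, the
first Koszul homology of `θ` vanishes. The alternating matrix of coefficients is written as
`bᵢⱼ - bⱼᵢ`. -/
def HasKoszulSyzygies {R ι : Type*} [CommRing R] [Fintype ι] (θ : ι → R) : Prop :=
  ∀ a : ι → R, ∑ i, a i * θ i = 0 → ∃ b : ι → ι → R, ∀ i, a i = ∑ j, (b i j - b j i) * θ j

/-- The condition `HasKoszulSyzygies` for the family obtained from `θ` by adjoining the element
`x`, with the coefficient of `x` in a syzygy kept apart. -/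
def HasKoszulSyzygiesWith {R ι : Type*} [CommRing R] [Fintype ι] (θ : ι → R) (x : R) : Prop :=
  ∀ (a : ι → R) (c : R), ∑ i, a i * θ i + c * x = 0 →
    ∃ (e : ι → R) (b : ι → ι → R), c = ∑ i, e i * θ i ∧
      ∀ i, a i = ∑ j, (b i j - b j i) * θ j - e i * x

theorem hasKoszulSyzygies_iff_succAbove {R : Type*} [CommRing R] {n : ℕ} (θ : Fin (n + 1) → R)
    (s : Fin (n + 1)) :
    HasKoszulSyzygies θ ↔ HasKoszulSyzygiesWith (fun m => θ (s.succAbove m)) (θ s) := by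
  constructor
  · intro H a c hac
    obtain ⟨b, hb⟩ := H (s.insertNth (α := fun _ => R) c a) (by
      rw [Fin.sum_univ_succAbove _ s]
      simp only [Fin.insertNth_apply_same, Fin.insertNth_apply_succAbove]
      rw [← hac, add_comm])
    refine ⟨fun i => b s (s.succAbove i) - b (s.succAbove i) s,
      fun i j => b (s.succAbove i) (s.succAbove j), ?_, fun i => ?_⟩
    · have := hb s
      rw [Fin.sum_univ_succAbove _ s] at this
      simpa using this
    · have := hb (s.succAbove i)
      rw [Fin.sum_univ_succAbove _ s] at this
      simp only [Fin.insertNth_apply_succAbove] at this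
      rw [this]
      ring
  · intro H a ha
    obtain ⟨e, b, hc, hb⟩ := H (fun m => a (s.succAbove m)) (a s) (by
      rw [Fin.sum_univ_succAbove _ s] at ha
      rw [← ha, add_comm])
    refine ⟨s.insertNth (α := fun _ => Fin (n + 1) → R) (s.insertNth (α := fun _ => R) 0 e)
      (fun i => s.insertNth (α := fun _ => R) 0 (b i)), fun i => ?_⟩
    rw [Fin.sum_univ_succAbove _ s]
    induction i using s.succAboveCases with
    | x => simpa using hc
    | p i =>
      simp only [Fin.insertNth_apply_same, Fin.insertNth_apply_succAbove]
      rw [hb i]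
      ring

section Koszul

variable {R ι : Type*} [CommRing R] [Fintype ι] {θ : ι → R} {x y : R}

theorem HasKoszulSyzygiesWith.of_isUnit (hx : IsUnit x) : HasKoszulSyzygiesWith θ x := by
  intro a c hac
  obtain ⟨v, hv⟩ := hx.exists_left_inv
  refine ⟨fun i => -(v * a i), fun _ _ => 0, ?_, fun i => ?_⟩
  · have : c = v * (c * x) := by rw [mul_left_comm, hv, mul_one]
    rw [this, eq_neg_of_add_eq_zero_right hac, ← Finset.sum_neg_distrib, Finset.mul_sum]
    exact Finset.sum_congr rfl fun i _ => by ring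
  · simp only [sub_self, zero_mul, Finset.sum_const_zero]
    linear_combination -(a i) * hv

/-- An element adjoined to a family with only Koszul syzygies is a nonzerodivisor modulo the ideal
generated by that family. -/
theorem HasKoszulSyzygiesWith.mem_span (H : HasKoszulSyzygiesWith θ x) {f : R}
    (hf : x * f ∈ Ideal.span (Set.range θ)) : f ∈ Ideal.span (Set.range θ) := by
  obtain ⟨a, ha⟩ := Ideal.mem_span_range_iff_exists_fun.1 hf
  obtain ⟨e, -, he, -⟩ := H (fun i => -a i) f (by
    simp only [neg_mul, Finset.sum_neg_distrib, ha]
    ring)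
  exact Ideal.mem_span_range_iff_exists_fun.2 ⟨e, he.symm⟩

theorem HasKoszulSyzygiesWith.mul (hx : HasKoszulSyzygiesWith θ x)
    (hy : HasKoszulSyzygiesWith θ y) : HasKoszulSyzygiesWith θ (x * y) := by
  intro a c hac
  obtain ⟨d, b, hd, hb⟩ := hy a (c * x) (by rw [mul_assoc]; exact hac)
  obtain ⟨e, b', he, hb'⟩ := hx (fun i => -d i) c (by
    simp only [neg_mul, Finset.sum_neg_distrib, hd]
    ring)
  refine ⟨e, fun i j => b i j + b' i j * y, he, fun i => ?_⟩
  have h1 : ∑ j, (b i j + b' i j * y - (b j i + b' j i * y)) * θ j =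
      ∑ j, (b i j - b j i) * θ j + (∑ j, (b' i j - b' j i) * θ j) * y := by
    rw [Finset.sum_mul, ← Finset.sum_add_distrib]
    exact Finset.sum_congr rfl fun j _ => by ring
  rw [h1, hb i]
  linear_combination y * hb' i

theorem HasKoszulSyzygiesWith.add_mem_span (hx : HasKoszulSyzygiesWith θ x)
    (hy : y ∈ Ideal.span (Set.range θ)) : HasKoszulSyzygiesWith θ (x + y) := by
  obtain ⟨d, rfl⟩ := Ideal.mem_span_range_iff_exists_fun.1 hy
  intro a c hac
  obtain ⟨e, b, he, hb⟩ := hx (fun i => a i + c * d i) c (by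
    rw [← hac]
    simp only [add_mul, mul_add, Finset.sum_add_distrib, Finset.mul_sum, mul_assoc]
    ring)
  -- The two correction terms `eᵢ dⱼ θⱼ` and `-c dᵢ` combine into an alternating one.
  refine ⟨e, fun i j => b i j + e i * d j, he, fun i => ?_⟩
  have h1 : ∑ j, (b i j + e i * d j - (b j i + e j * d i)) * θ j =
      ∑ j, (b i j - b j i) * θ j + e i * ∑ j, d j * θ j - (∑ j, e j * θ j) * d i := by
    rw [Finset.sum_mul, Finset.mul_sum, ← Finset.sum_add_distrib, ← Finset.sum_sub_distrib]
    exact Finset.sum_congr rfl fun j _ => by ring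
  rw [h1, ← he]
  linear_combination hb i

/-- If the images of `θ` modulo a nonzerodivisor `x` have only Koszul syzygies, then so has `θ`
with `x` adjoined. -/
theorem HasKoszulSyzygiesWith.of_surjective {S : Type*} [CommRing S] (φ : R →+* S)
    (hφ : Function.Surjective φ) (hker : RingHom.ker φ = Ideal.span {x})
    (hx : x ∈ nonZeroDivisors R) (H : HasKoszulSyzygies fun i => φ (θ i)) :
    HasKoszulSyzygiesWith θ x := by
  intro a c hac
  have hφx : φ x = 0 := by
    rw [← RingHom.mem_ker, hker]
    exact Ideal.mem_span_singleton_self x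
  obtain ⟨b', hb'⟩ := H (fun i => φ (a i)) (by
    simpa [hφx] using congrArg φ hac)
  choose b hb using fun i j => hφ (b' i j)
  have hdvd : ∀ i, x ∣ a i - ∑ j, (b i j - b j i) * θ j := fun i => by
    rw [← Ideal.mem_span_singleton, ← hker, RingHom.mem_ker]
    simp [hb, hb' i]
  choose e he using hdvd
  refine ⟨fun i => -e i, b, ?_, fun i => by linear_combination he i⟩
  have h0 : ∑ i, (∑ j, (b i j - b j i) * θ j) * θ i = 0 := by
    simp only [Finset.sum_mul, sub_mul, Finset.sum_sub_distrib]
    rw [Finset.sum_comm, sub_eq_zero]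
    exact Finset.sum_congr rfl fun i _ => Finset.sum_congr rfl fun j _ => by ring
  have h1 : ∑ i, a i * θ i = x * ∑ i, e i * θ i := by
    rw [← sub_zero (∑ i, a i * θ i), ← h0, ← Finset.sum_sub_distrib, Finset.mul_sum]
    exact Finset.sum_congr rfl fun i _ => by linear_combination θ i * he i
  rw [← sub_eq_zero]
  refine (mem_nonZeroDivisors_iff.1 hx).2 _ ?_
  simp only [neg_mul, Finset.sum_neg_distrib]
  linear_combination hac - h1

end Koszul

/-! ### The sums `g` and `f` for a sequence of ring elements -/

/-- The sum `∑_{k < j} ∏_{j ≤ l < b} (x k - x l)` attached to a sequence `x`. The polynomial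
`g_{i,j}` is the case `b = i` if the variables are numbered from `0`. -/
def diffSum {R : Type*} [CommRing R] (x : ℕ → R) (b j : ℕ) : R :=
  ∑ k ∈ Finset.range j, ∏ l ∈ Finset.Ico j b, (x k - x l)

/-- The sum `∑_{k < j} (∏_{j ≤ l < b} (x k - x l)) x k` attached to a sequence `x`, with the
indexing of `diffSum`. -/
def weightedDiffSum {R : Type*} [CommRing R] (x : ℕ → R) (b j : ℕ) : R :=
  ∑ k ∈ Finset.range j, (∏ l ∈ Finset.Ico j b, (x k - x l)) * x k

section Sums

variable {R : Type*} [CommRing R] (x : ℕ → R)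

theorem weightedDiffSum_succ {b j : ℕ} (hj : j < b) :
    weightedDiffSum x b (j + 1) = x j * diffSum x b (j + 1) + diffSum x b j := by
  unfold weightedDiffSum diffSum
  rw [Finset.sum_range_succ, Finset.sum_range_succ, mul_add, Finset.mul_sum, add_right_comm,
    mul_comm (x j), ← Finset.sum_add_distrib]
  congr 1
  refine Finset.sum_congr rfl fun k _ => ?_
  rw [Finset.prod_eq_prod_Ico_succ_bot hj]
  ring

theorem diffSum_succ {b j : ℕ} (hj : j ≤ b) :
    diffSum x (b + 1) j = weightedDiffSum x b j - x b * diffSum x b j := by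
  unfold weightedDiffSum diffSum
  rw [Finset.mul_sum, ← Finset.sum_sub_distrib]
  refine Finset.sum_congr rfl fun k _ => ?_
  rw [Finset.prod_Ico_succ_top hj]
  ring

/-- An ideal that contains `diffSum x (β m) (m + 1)` for all `m < t`, where `β` is weakly
increasing, contains all the sums with at most `t` terms and with larger upper ends: the two
recursions express the sum with `j + 1` terms and upper end `b + 1` through sums with upper end
`b` and at most `j + 1` terms. -/
theorem diffSum_mem {I : Ideal R} {β : ℕ → ℕ} {t : ℕ} (hβ : ∀ m < t, m < β m)
    (hmono : ∀ m m', m ≤ m' → m' < t → β m ≤ β m')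
    (hI : ∀ m < t, diffSum x (β m) (m + 1) ∈ I) {j : ℕ} (hj : j ≤ t) {b : ℕ}
    (hb : ∀ m < j, β m ≤ b) : diffSum x b j ∈ I := by
  induction j generalizing b with
  | zero => simp [diffSum]
  | succ j ih =>
    have hjt : j < t := hj
    have hjb := hb j (Nat.lt_succ_self j)
    clear hb
    induction b, hjb using Nat.le_induction with
    | base => exact hI j hjt
    | succ b hjb ihb =>
      have hlt : j < b := (hβ j hjt).trans_le hjb
      rw [diffSum_succ x hlt, weightedDiffSum_succ x hlt]
      exact I.sub_mem (I.add_mem (I.mul_mem_left _ ihb)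
        (ih hjt.le fun m hm => (hmono m j hm.le hjt).trans hjb)) (I.mul_mem_left _ ihb)

theorem map_diffSum {S : Type*} [CommRing S] (φ : R →+* S) (b j : ℕ) :
    φ (diffSum x b j) = diffSum (fun k => φ (x k)) b j := by
  simp [diffSum, map_sum, map_prod]

theorem map_weightedDiffSum {S : Type*} [CommRing S] (φ : R →+* S) (b j : ℕ) :
    φ (weightedDiffSum x b j) = weightedDiffSum (fun k => φ (x k)) b j := by
  simp [weightedDiffSum, map_sum, map_prod]

theorem diffSum_self (j : ℕ) : diffSum x j j = j := by
  simp [diffSum]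

end Sums

/-! ### Inserting a zero into the sequence -/

/-- The sequence `y 0, …, y (s - 1), 0, y s, y (s + 1), …`. -/
def insertZero {R : Type*} [Zero R] (y : ℕ → R) (s k : ℕ) : R :=
  if k < s then y k else if k = s then 0 else y (k - 1)

section InsertZero

variable {R : Type*}

theorem insertZero_of_lt [Zero R] (y : ℕ → R) {s k : ℕ} (h : k < s) :
    insertZero y s k = y k := if_pos h

@[simp]
theorem insertZero_self [Zero R] (y : ℕ → R) (s : ℕ) : insertZero y s s = 0 := by
  simp [insertZero]

theorem insertZero_succ [Zero R] (y : ℕ → R) {s k : ℕ} (h : s ≤ k) :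
    insertZero y s (k + 1) = y k := by
  rw [insertZero, if_neg (by omega), if_neg (by omega), Nat.add_sub_cancel]

variable [CommRing R] (y : ℕ → R) {s b j : ℕ}

theorem diffSum_insertZero_of_le (hb : b ≤ s) :
    diffSum (insertZero y s) b j = diffSum y b j := by
  refine Finset.sum_congr rfl fun k hk => Finset.prod_congr rfl fun l hl => ?_
  rw [Finset.mem_range] at hk
  rw [Finset.mem_Ico] at hl
  rw [insertZero_of_lt y (by omega), insertZero_of_lt y (by omega)]

/-- The factor `x k - x s` of each product becomes `y k`, which turns `g` into `f`. -/
theorem diffSum_insertZero (hj : j ≤ s) (hb : s ≤ b) :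
    diffSum (insertZero y s) (b + 1) j = weightedDiffSum y b j := by
  refine Finset.sum_congr rfl fun k hk => ?_
  rw [insertZero_of_lt y ((Finset.mem_range.1 hk).trans_le hj)]
  induction b, hb using Nat.le_induction with
  | base =>
    rw [Finset.prod_Ico_succ_top hj, insertZero_self, sub_zero]
    congr 1
    exact Finset.prod_congr rfl fun l hl => by
      rw [insertZero_of_lt y (Finset.mem_Ico.1 hl).2]
  | succ b hb ih =>
    rw [Finset.prod_Ico_succ_top (by omega), ih, insertZero_succ y hb,
      Finset.prod_Ico_succ_top (by omega)]
    ring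

/-- The summand of index `s` vanishes because of its weight. -/
theorem weightedDiffSum_insertZero (hj : s ≤ j) :
    weightedDiffSum (insertZero y s) (b + 1) (j + 1) = weightedDiffSum y b j := by
  have hprod : ∀ u, ∏ l ∈ Finset.Ico (j + 1) (b + 1), (u - insertZero y s l) =
      ∏ l ∈ Finset.Ico j b, (u - y l) := fun u => by
    rw [← Finset.prod_Ico_add']
    exact Finset.prod_congr rfl fun l hl => by
      rw [insertZero_succ y (hj.trans (Finset.mem_Ico.1 hl).1)]
  have hsum : ∀ W : R → R, W 0 = 0 → ∑ k ∈ Finset.range (j + 1), W (insertZero y s k) =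
      ∑ k ∈ Finset.range j, W (y k) := fun W hW => by
    clear hprod
    induction j, hj using Nat.le_induction with
    | base =>
      rw [Finset.sum_range_succ, insertZero_self, hW, add_zero]
      exact Finset.sum_congr rfl fun k hk => by
        rw [insertZero_of_lt y (Finset.mem_range.1 hk)]
    | succ j hj ih =>
      rw [Finset.sum_range_succ, ih, Finset.sum_range_succ, insertZero_succ y hj]
  unfold weightedDiffSum
  simp only [hprod]
  exact hsum (fun u => (∏ l ∈ Finset.Ico j b, (u - y l)) * u) (mul_zero _)

end InsertZero

namespace HessenbergFunction

open MvPolynomial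

/-! ### The generators of the ideals -/

/-- The variables of `ℚ[x_0, …, x_{n-1}]` as a sequence, continued by zeros. -/
noncomputable def varSeq (n : ℕ) (k : ℕ) : MvPolynomial (Fin n) ℚ :=
  if hk : k < n then X ⟨k, hk⟩ else 0

theorem varSeq_val {n : ℕ} (k : Fin n) : varSeq n k = X k := dif_pos k.isLt

theorem gPoly_eq_diffSum {n : ℕ} (i j : Fin n) :
    gPoly i j = diffSum (varSeq n) (i + 1) (j + 1) := by
  have h1 : Finset.range (j + 1) = (Finset.Iic j).map Fin.valEmbedding := by
    ext; simp
  have h2 : Finset.Ico ((j : ℕ) + 1) (i + 1) = (Finset.Ioc j i).map Fin.valEmbedding := by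
    rw [Fin.map_valEmbedding_Ioc]; ext; simp
  simp only [gPoly, diffSum, h1, h2, Finset.sum_map, Finset.prod_map, Fin.valEmbedding_apply,
    varSeq_val]

theorem fPoly_eq_weightedDiffSum {n : ℕ} (i j : Fin n) :
    fPoly i j = weightedDiffSum (varSeq n) (i + 1) (j + 1) := by
  have h1 : Finset.range (j + 1) = (Finset.Iic j).map Fin.valEmbedding := by
    ext; simp
  have h2 : Finset.Ico ((j : ℕ) + 1) (i + 1) = (Finset.Ioc j i).map Fin.valEmbedding := by
    rw [Fin.map_valEmbedding_Ioc]; ext; simp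
  simp only [fPoly, weightedDiffSum, h1, h2, Finset.sum_map, Finset.prod_map,
    Fin.valEmbedding_apply, varSeq_val]

/-- The generator of `h.idealA t` at position `m`. -/
noncomputable def gen {n : ℕ} (h : HessenbergFunction n) (t : ℕ) (m : Fin n) :
    MvPolynomial (Fin n) ℚ :=
  if (m : ℕ) < t then gPoly (h.toFun m) m else fPoly (h.toFun m) m

theorem gen_of_lt {n : ℕ} (h : HessenbergFunction n) {t : ℕ} {m : Fin n} (hm : (m : ℕ) < t) :
    h.gen t m = gPoly (h.toFun m) m := if_pos hm

theorem gen_of_le {n : ℕ} (h : HessenbergFunction n) {t : ℕ} {m : Fin n} (hm : t ≤ (m : ℕ)) :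
    h.gen t m = fPoly (h.toFun m) m := if_neg hm.not_gt

theorem idealA_eq_span {n : ℕ} (h : HessenbergFunction n) (t : ℕ) :
    h.idealA t = Ideal.span (Set.range (h.gen t)) := rfl

theorem gen_mem {n : ℕ} (h : HessenbergFunction n) (t : ℕ) (m : Fin n) :
    h.gen t m ∈ h.idealA t :=
  Ideal.subset_span ⟨m, rfl⟩

theorem gen_succ_succAbove {n : ℕ} (h : HessenbergFunction (n + 1)) (s : Fin (n + 1))
    (m : Fin n) : h.gen (s + 1) (s.succAbove m) = h.gen s (s.succAbove m) := by
  have hne : ((s.succAbove m : Fin (n + 1)) : ℕ) ≠ s := fun h => s.succAbove_ne m (Fin.ext h)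
  unfold gen
  rcases lt_or_gt_of_ne hne with h | h
  · rw [if_pos h, if_pos (h.trans (Nat.lt_succ_self _))]
  · rw [if_neg h.le.not_gt, if_neg (Nat.succ_le_of_lt h).not_gt]

/-- The difference `f - x_s g` at position `s`, a sum with one term less, lies in every ideal that
contains the `g`'s at the positions before `s`. -/
theorem fPoly_sub_mem {n : ℕ} (h : HessenbergFunction n) (s : Fin n)
    {I : Ideal (MvPolynomial (Fin n) ℚ)} (hI : ∀ m < s, gPoly (h.toFun m) m ∈ I) :
    fPoly (h.toFun s) s - X s * gPoly (h.toFun s) s ∈ I := by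
  have hs := Fin.le_def.1 (h.le_toFun s)
  rw [fPoly_eq_weightedDiffSum, gPoly_eq_diffSum, weightedDiffSum_succ _ (by omega), varSeq_val,
    add_sub_cancel_left]
  let β : ℕ → ℕ := fun m => if hm : m < n then (h.toFun ⟨m, hm⟩ : ℕ) + 1 else 0
  have hβ : ∀ m : Fin n, β m = (h.toFun m : ℕ) + 1 := fun m => dif_pos m.isLt
  refine diffSum_mem (t := s) (β := β) _ ?_ ?_ ?_ le_rfl ?_
  · intro m hm
    lift m to Fin n using hm.trans s.isLt
    rw [hβ]
    exact Nat.lt_succ_of_le (h.le_toFun m)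
  · intro m m' hmm hm'
    lift m' to Fin n using hm'.trans s.isLt
    lift m to Fin n using hmm.trans_lt m'.isLt
    rw [hβ, hβ]
    exact Nat.succ_le_succ (h.monotone_toFun hmm)
  · intro m hm
    lift m to Fin n using hm.trans s.isLt
    rw [hβ, ← gPoly_eq_diffSum]
    exact hI m hm
  · intro m hm
    lift m to Fin n using hm.trans s.isLt
    rw [hβ]
    exact Nat.succ_le_succ (h.monotone_toFun (Fin.le_def.2 hm.le))

theorem X_mul_mem {n : ℕ} (h : HessenbergFunction (n + 1)) (s : Fin (n + 1))
    {f : MvPolynomial (Fin (n + 1)) ℚ} (hf : f ∈ h.idealA (s + 1)) :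
    X s * f ∈ h.idealA s := by
  suffices h.idealA (s + 1) ≤ Submodule.comap
    (LinearMap.mulLeft (MvPolynomial (Fin (n + 1)) ℚ) (X s)) (h.idealA s) from this hf
  rw [idealA_eq_span, Ideal.span, Submodule.span_le]
  rintro _ ⟨m, rfl⟩
  change X s * h.gen (s + 1) m ∈ h.idealA s
  induction m using s.succAboveCases with
  | x =>
    have h1 := h.fPoly_sub_mem s (I := h.idealA s) fun m hm => by
      rw [← h.gen_of_lt (Fin.lt_def.1 hm)]
      exact h.gen_mem s m
    have h2 := (h.idealA s).sub_mem (h.gen_mem s s) h1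
    rwa [h.gen_of_le le_rfl, sub_sub_cancel, ← h.gen_of_lt (Nat.lt_succ_self s)] at h2
  | p m =>
    rw [gen_succ_succAbove]
    exact Ideal.mul_mem_left _ _ (h.gen_mem s _)

theorem r_le {n : ℕ} (h : HessenbergFunction n) (s : Fin n) : h.r s ≤ s :=
  not_lt.1 fun hs => (h.le_toFun s).not_gt (h.lt_of_lt_r s s hs)

/-! ### Setting a variable to zero -/

/-- The homomorphism `ℚ[x_0, …, x_n] → ℚ[y_0, …, y_{n-1}]` that sends `x_s` to `0` and the other
variables to the `y`'s in their order. -/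
noncomputable def killVar {n : ℕ} (s : Fin (n + 1)) :
    MvPolynomial (Fin (n + 1)) ℚ →ₐ[ℚ] MvPolynomial (Fin n) ℚ :=
  aeval (s.insertNth (α := fun _ => MvPolynomial (Fin n) ℚ) 0 X)

section killVar

variable {n : ℕ} (s : Fin (n + 1))

@[simp]
theorem killVar_X_self : killVar s (X s) = 0 := by simp [killVar]

@[simp]
theorem killVar_X_succAbove (m : Fin n) : killVar s (X (s.succAbove m)) = X m := by
  simp [killVar]

theorem killVar_surjective : Function.Surjective (killVar s) := fun q => by
  refine ⟨rename s.succAbove q, ?_⟩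
  have : (killVar s).comp (rename s.succAbove) = AlgHom.id ℚ _ := by
    ext m : 1
    simp
  exact DFunLike.congr_fun this q

theorem ker_killVar : RingHom.ker (killVar s) = Ideal.span {X s} := by
  refine le_antisymm (fun q hq => ?_) ?_
  · have : (Ideal.Quotient.mkₐ ℚ (Ideal.span {X s})).comp
        ((rename s.succAbove).comp (killVar s)) = Ideal.Quotient.mkₐ ℚ (Ideal.span {X s}) := by
      ext m : 1
      induction m using s.succAboveCases with
      | x =>
        simp
      | p m => simp
    rw [← Ideal.Quotient.eq_zero_iff_mem]
    have h := DFunLike.congr_fun this q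
    simpa [RingHom.mem_ker.1 hq] using h.symm
  · rw [Ideal.span_singleton_le_iff_mem, RingHom.mem_ker, killVar_X_self]

theorem killVar_varSeq (k : ℕ) :
    killVar s (varSeq (n + 1) k) = insertZero (varSeq n) s k := by
  have hs := s.isLt
  by_cases hk : k < n + 1
  · lift k to Fin (n + 1) using hk
    rw [varSeq_val]
    induction k using s.succAboveCases with
    | x => rw [killVar_X_self, insertZero_self]
    | p m =>
      rw [killVar_X_succAbove, ← varSeq_val]
      by_cases hm : (m : ℕ) < s
      · rw [Fin.succAbove_of_castSucc_lt _ _ (Fin.lt_def.2 hm), Fin.val_castSucc,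
          insertZero_of_lt _ hm]
      · rw [Fin.succAbove_of_le_castSucc _ _ (Fin.le_def.2 (not_lt.1 hm)), Fin.val_succ,
          insertZero_succ _ (not_lt.1 hm)]
  · obtain ⟨k, rfl⟩ : ∃ j, k = j + 1 := ⟨k - 1, by omega⟩
    rw [insertZero_succ _ (by omega), varSeq, varSeq, dif_neg hk, dif_neg (by omega), map_zero]

/-- Setting `x_s = 0` turns the generators of `h.idealA s` at the positions other than `s` into
those for the Hessenberg function with row and column `s` deleted. -/
theorem killVar_gen (h : HessenbergFunction (n + 1)) (m : Fin n) :
    killVar s (h.gen s (s.succAbove m)) = (h.remove s).gen (h.r s) m := by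
  have hrs := Fin.le_def.1 (h.r_le s)
  have hval : ((h.remove s).toFun m : ℕ) = h.removeVal s m := rfl
  have h1 := Fin.le_def.1 (h.le_toFun m.castSucc)
  have h2 := Fin.le_def.1 (h.le_toFun m.succ)
  rw [Fin.val_castSucc] at h1
  rw [Fin.val_succ] at h2
  have hfun : (fun k => (killVar s : _ →+* MvPolynomial (Fin n) ℚ) (varSeq (n + 1) k)) =
      insertZero (varSeq n) s := funext (killVar_varSeq s)
  by_cases hm : (m : ℕ) < s
  · rw [Fin.succAbove_of_castSucc_lt _ _ (Fin.lt_def.2 hm), gen_of_lt _ (by simpa using hm),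
      gPoly_eq_diffSum, ← AlgHom.coe_toRingHom, map_diffSum, hfun, Fin.val_castSucc]
    by_cases hr : (m : ℕ) < h.r s
    · have h3 := Fin.lt_def.1 (h.lt_of_lt_r s m.castSucc (Fin.lt_def.2 (by simpa using hr)))
      rw [diffSum_insertZero_of_le _ (by omega), gen_of_lt _ hr, gPoly_eq_diffSum, hval,
        removeVal, if_pos hr]
    · have h3 := Fin.le_def.1 (h.le_of_r_le s m.castSucc (Fin.le_def.2 (by simpa using hr)))
      rw [diffSum_insertZero _ (by omega) (by omega), gen_of_le _ (not_lt.1 hr),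
        fPoly_eq_weightedDiffSum, hval, removeVal, if_neg hr, if_pos hm,
        Nat.sub_add_cancel (by omega)]
  · rw [Fin.succAbove_of_le_castSucc _ _ (Fin.le_def.2 (not_lt.1 hm)),
      gen_of_le _ (by rw [Fin.val_succ]; omega),
      fPoly_eq_weightedDiffSum, ← AlgHom.coe_toRingHom, map_weightedDiffSum, hfun, Fin.val_succ,
      weightedDiffSum_insertZero _ (by omega), gen_of_le _ (by omega),
        fPoly_eq_weightedDiffSum, hval, removeVal, if_neg (by omega), if_neg hm,
        Nat.sub_add_cancel (by omega)]

end killVar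

/-! ### Injectivity of the multiplication by `x_s` -/

/-- At a fixed point `s` of `h` the polynomial `g` is a nonzero constant. -/
theorem isUnit_gPoly_self {n : ℕ} (s : Fin n) : IsUnit (gPoly s s) := by
  rw [gPoly_eq_diffSum, diffSum_self]
  have : (((s + 1 : ℕ) : ℚ)) ≠ 0 := by positivity
  simpa using (IsUnit.mk0 _ this).map (algebraMap ℚ (MvPolynomial (Fin n) ℚ))

theorem lt_toFun_of_lt_p {n : ℕ} (h : HessenbergFunction (n + 1)) {m : Fin (n + 1)}
    (hm : m < h.p) : m < h.toFun m :=
  lt_of_le_of_ne (h.le_toFun m) fun heq =>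
    hm.not_ge (Finset.min'_le (Finset.univ.filter fun m => h.toFun m = m) _
      (Finset.mem_filter.2 ⟨Finset.mem_univ _, heq.symm⟩))

theorem toFun_p {n : ℕ} (h : HessenbergFunction (n + 1)) : h.toFun h.p = h.p :=
  (Finset.mem_filter.1 (Finset.min'_mem
    (Finset.univ.filter fun m : Fin (n + 1) => h.toFun m = m) _)).2

theorem hasKoszulSyzygiesWith_X {n : ℕ} (h : HessenbergFunction (n + 1)) (s : Fin (n + 1))
    (H : HasKoszulSyzygies ((h.remove s).gen (h.r s))) :
    HasKoszulSyzygiesWith (fun m => h.gen s (s.succAbove m)) (X s) := by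
  refine .of_surjective (killVar s : _ →+* MvPolynomial (Fin n) ℚ) (killVar_surjective s)
    (ker_killVar s) (mem_nonZeroDivisors_of_ne_zero (X_ne_zero s)) ?_
  simpa only [AlgHom.coe_toRingHom, killVar_gen] using H

theorem hasKoszulSyzygies_gen_succ_iff {n : ℕ} (h : HessenbergFunction (n + 1))
    (s : Fin (n + 1)) : HasKoszulSyzygies (h.gen (s + 1)) ↔
      HasKoszulSyzygiesWith (fun m => h.gen s (s.succAbove m)) (gPoly (h.toFun s) s) := by
  rw [hasKoszulSyzygies_iff_succAbove _ s, h.gen_of_lt (Nat.lt_succ_self s)]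
  simp only [gen_succ_succAbove]

theorem fPoly_sub_mem_span {n : ℕ} (h : HessenbergFunction (n + 1)) (s : Fin (n + 1)) :
    fPoly (h.toFun s) s - X s * gPoly (h.toFun s) s ∈
      Ideal.span (Set.range fun m => h.gen s (s.succAbove m)) := by
  refine h.fPoly_sub_mem s fun m hm => ?_
  obtain ⟨k, rfl⟩ := Fin.exists_succAbove_eq hm.ne
  rw [← h.gen_of_lt (Fin.lt_def.1 hm)]
  exact Ideal.subset_span ⟨k, rfl⟩

theorem lt_remove {n : ℕ} (h : HessenbergFunction (n + 1)) {s : Fin (n + 1)} (hs : s ≤ h.p)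
    {m : Fin n} (hm : (m : ℕ) < h.r s) : m < (h.remove s).toFun m := by
  have hr := Fin.le_def.1 (h.r_le s)
  have := h.lt_toFun_of_lt_p (m := m.castSucc)
    (Fin.lt_def.2 (by rw [Fin.val_castSucc]; exact hm.trans_le (hr.trans hs)))
  rw [Fin.lt_def, Fin.val_castSucc] at this
  change (m : ℕ) < h.removeVal s m
  rwa [removeVal, if_pos hm]

/-- The generators of `h.idealA t` have only Koszul syzygies if `t ≤ p(h) + 1`, a condition put
here in a form that makes sense for `n = 0` too. Downward induction on `t` reduces `f` at position
`s` to the product of `x_s` and `g`, and the case of `x_s` comes from `n - 1` variables. -/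
theorem hasKoszulSyzygies_gen {n : ℕ} (h : HessenbergFunction n) {t : ℕ} (htn : t ≤ n)
    (ht : ∀ m : Fin n, (m : ℕ) + 1 < t → m < h.toFun m) : HasKoszulSyzygies (h.gen t) := by
  induction n generalizing t with
  | zero => exact fun a _ => ⟨fun _ _ => 0, fun i => i.elim0⟩
  | succ n ih =>
    have htp : t ≤ h.p + 1 := by
      by_contra hc
      exact (ht h.p (by omega)).ne h.toFun_p.symm
    clear ht htn
    induction htp using Nat.decreasingInduction with
    | self =>
      rw [hasKoszulSyzygies_gen_succ_iff]
      refine .of_isUnit ?_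
      rw [toFun_p]
      exact isUnit_gPoly_self _
    | of_succ s hs ihs =>
      lift s to Fin (n + 1) using hs.trans_le h.p.isLt
      have hR : HasKoszulSyzygies ((h.remove s).gen (h.r s)) := by
        have hr := Fin.le_def.1 (h.r_le s)
        refine ih _ (hr.trans (Nat.le_of_lt_succ s.isLt)) fun m hm => ?_
        exact h.lt_remove (Fin.le_def.2 (Nat.le_of_lt_succ hs)) (by omega)
      rw [hasKoszulSyzygies_gen_succ_iff] at ihs
      rw [hasKoszulSyzygies_iff_succAbove _ s, h.gen_of_le le_rfl,
        ← add_sub_cancel (X s * gPoly (h.toFun s) s) (fPoly (h.toFun s) s)]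
      exact ((h.hasKoszulSyzygiesWith_X s hR).mul ihs).add_mem_span (h.fPoly_sub_mem_span s)

/-- At `t = p(h) + 1` the generator at position `p(h)` is a unit. -/
theorem idealA_p_succ {n : ℕ} (h : HessenbergFunction (n + 1)) : h.idealA (h.p + 1) = ⊤ := by
  refine Ideal.eq_top_of_isUnit_mem _ (h.gen_mem (h.p + 1) h.p) ?_
  rw [h.gen_of_lt (Nat.lt_succ_self _), toFun_p]
  exact isUnit_gPoly_self _

theorem hasKoszulSyzygies_remove {n : ℕ} (h : HessenbergFunction (n + 1)) {s : Fin (n + 1)}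
    (hs : s ≤ h.p) : HasKoszulSyzygies ((h.remove s).gen (h.r s)) := by
  have hr := Fin.le_def.1 (h.r_le s)
  refine hasKoszulSyzygies_gen _ (hr.trans (Nat.le_of_lt_succ s.isLt)) fun m hm => ?_
  exact h.lt_remove hs (by omega)

/-- The multiplication by `x_s` is injective: modulo the generators of `h.idealA s` at the positions
other than `s`, the remaining generator is `x_s g`, and `x_s` is a nonzerodivisor. -/
theorem mem_idealA_succ_of_X_mul_mem {n : ℕ} (h : HessenbergFunction (n + 1)) {s : Fin (n + 1)}
    (hs : s ≤ h.p) {f : MvPolynomial (Fin (n + 1)) ℚ} (hf : X s * f ∈ h.idealA s) :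
    f ∈ h.idealA (s + 1) := by
  have hle : Ideal.span (Set.range fun m => h.gen s (s.succAbove m)) ≤ h.idealA (s + 1) := by
    rw [Ideal.span_le]
    rintro _ ⟨m, rfl⟩
    dsimp only
    rw [← gen_succ_succAbove]
    exact h.gen_mem _ _
  obtain ⟨a, ha⟩ := Ideal.mem_span_range_iff_exists_fun.1 hf
  change ∑ m, a m * h.gen s m = _ at ha
  rw [Fin.sum_univ_succAbove _ s, h.gen_of_le le_rfl] at ha
  have hmem : X s * (f - a s * gPoly (h.toFun s) s) ∈
      Ideal.span (Set.range fun m => h.gen s (s.succAbove m)) := by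
    have h1 : X s * (f - a s * gPoly (h.toFun s) s) =
        a s * (fPoly (h.toFun s) s - X s * gPoly (h.toFun s) s) +
          ∑ m, a (s.succAbove m) * h.gen s (s.succAbove m) := by
      linear_combination -ha
    rw [h1]
    exact Ideal.add_mem _ (Ideal.mul_mem_left _ _ (h.fPoly_sub_mem_span s))
      (Ideal.mem_span_range_iff_exists_fun.2 ⟨_, rfl⟩)
  have h2 := hle ((h.hasKoszulSyzygiesWith_X s (h.hasKoszulSyzygies_remove hs)).mem_span hmem)
  rw [← sub_add_cancel f (a s * gPoly (h.toFun s) s)]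
  refine Ideal.add_mem _ h2 (Ideal.mul_mem_left _ _ ?_)
  rw [← h.gen_of_lt (Nat.lt_succ_self s)]
  exact h.gen_mem _ _

/-! ### The multiplication maps and the quotients -/

/-- Multiplication by `x_s` as a map `h.A (s + 1) → h.A s`, continued by zero maps to the `s` for
which there is no variable `x_s`. -/
noncomputable def mulX {n : ℕ} (h : HessenbergFunction (n + 1)) (s : ℕ) :
    h.A (s + 1) →ₗ[MvPolynomial (Fin (n + 1)) ℚ] h.A s :=
  if hs : s < n + 1 then
    Submodule.mapQ (h.idealA (s + 1)) (h.idealA s) (LinearMap.mulLeft _ (X ⟨s, hs⟩))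
      fun _ hf => h.X_mul_mem ⟨s, hs⟩ hf
  else 0

theorem mulX_mkA {n : ℕ} (h : HessenbergFunction (n + 1)) (s : Fin (n + 1))
    (f : MvPolynomial (Fin (n + 1)) ℚ) :
    h.mulX s (h.mkA (s + 1) f) = h.mkA s (X s * f) := by
  rw [mulX, dif_pos s.isLt]
  rfl

theorem mulX_injective {n : ℕ} (h : HessenbergFunction (n + 1)) {s : Fin (n + 1)}
    (hs : s ≤ h.p) : Function.Injective (h.mulX s) := by
  rw [injective_iff_map_eq_zero]
  intro a ha
  obtain ⟨f, rfl⟩ := Ideal.Quotient.mk_surjective a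
  rw [mulX_mkA, Ideal.Quotient.eq_zero_iff_mem] at ha
  exact Ideal.Quotient.eq_zero_iff_mem.2 (h.mem_idealA_succ_of_X_mul_mem hs ha)

theorem range_mulX {n : ℕ} (h : HessenbergFunction (n + 1)) (s : Fin (n + 1)) :
    Set.range (h.mulX s) = Ideal.span {h.mkA s (X s)} := by
  ext a
  rw [SetLike.mem_coe, Ideal.mem_span_singleton']
  constructor
  · rintro ⟨b, rfl⟩
    obtain ⟨f, rfl⟩ := Ideal.Quotient.mk_surjective b
    exact ⟨h.mkA s f, by rw [mulX_mkA, map_mul, mul_comm]⟩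
  · rintro ⟨b, rfl⟩
    obtain ⟨f, rfl⟩ := Ideal.Quotient.mk_surjective b
    exact ⟨h.mkA (s + 1) f, by rw [mulX_mkA, map_mul, mul_comm]⟩

/-- The generator at position `s` contributes nothing, being `x_s g` modulo those before it. -/
theorem map_killVar_idealA {n : ℕ} (h : HessenbergFunction (n + 1)) (s : Fin (n + 1)) :
    (h.idealA s).map (killVar s) = (h.remove s).idealA (h.r s) := by
  rw [idealA_eq_span, Ideal.map_span]
  refine le_antisymm (Ideal.span_le.2 ?_) (Ideal.span_le.2 ?_)
  · rintro _ ⟨_, ⟨m, rfl⟩, rfl⟩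
    induction m using s.succAboveCases with
    | x =>
      have h1 := Ideal.mem_map_of_mem (killVar s) (h.fPoly_sub_mem_span s)
      rw [Ideal.map_span, ← Set.range_comp, map_sub, map_mul, killVar_X_self, zero_mul,
        sub_zero] at h1
      rw [h.gen_of_le le_rfl]
      simp only [Function.comp_def, killVar_gen] at h1
      exact h1
    | p m =>
      rw [killVar_gen]
      exact gen_mem _ _ m
  · rintro _ ⟨m, rfl⟩
    exact Ideal.subset_span ⟨_, ⟨_, rfl⟩, killVar_gen s h m⟩

/-- Setting `x_s = 0` identifies `h.A s ⧸ ⟨x_s⟩` with the ring of the Hessenberg function with row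
and column `s` deleted. -/
theorem exists_quotient_equiv {n : ℕ} (h : HessenbergFunction (n + 1)) (s : Fin (n + 1)) :
    ∃ e : (h.A s ⧸ Ideal.span {h.mkA s (X s)}) ≃ₐ[ℚ] (h.remove s).A (h.r s),
      ∀ f, e (Ideal.Quotient.mk _ (h.mkA s f)) = (h.remove s).mkA (h.r s) (killVar s f) := by
  let φ : h.A s →ₐ[ℚ] (h.remove s).A (h.r s) :=
    Ideal.Quotient.liftₐ (h.idealA s)
      ((Ideal.Quotient.mkₐ ℚ ((h.remove s).idealA (h.r s))).comp (killVar s)) fun f hf => by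
        refine Ideal.Quotient.eq_zero_iff_mem.2 ?_
        rw [← map_killVar_idealA]
        exact Ideal.mem_map_of_mem _ hf
  have hφ : ∀ f, φ (h.mkA s f) = (h.remove s).mkA (h.r s) (killVar s f) := fun f => rfl
  have hsurj : Function.Surjective φ := fun a => by
    obtain ⟨q, rfl⟩ := Ideal.Quotient.mk_surjective a
    obtain ⟨f, rfl⟩ := killVar_surjective s q
    exact ⟨_, hφ f⟩
  have hker : Ideal.span {h.mkA s (X s)} = RingHom.ker φ := by
    refine le_antisymm ?_ fun a ha => ?_
    · rw [Ideal.span_singleton_le_iff_mem, RingHom.mem_ker, hφ, killVar_X_self, map_zero]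
    · obtain ⟨f, rfl⟩ := Ideal.Quotient.mk_surjective a
      rw [RingHom.mem_ker, hφ, Ideal.Quotient.eq_zero_iff_mem, ← map_killVar_idealA,
        ← Ideal.mem_comap, Ideal.comap_map_of_surjective _ (killVar_surjective s)] at ha
      obtain ⟨u, hu, v, hv, rfl⟩ := Submodule.mem_sup.1 ha
      have hv' : v ∈ RingHom.ker (killVar s) := hv
      rw [ker_killVar] at hv'
      have := Ideal.mem_map_of_mem (h.mkA s) hv'
      rw [Ideal.map_span, Set.image_singleton] at this
      rwa [map_add, Ideal.Quotient.eq_zero_iff_mem.2 hu, zero_add]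
  exact ⟨(Ideal.quotientEquivAlgOfEq ℚ hker).trans
    (Ideal.quotientKerAlgEquivOfSurjective hsurj), fun f => rfl⟩

theorem chain_mulX_injective {n : ℕ} (h : HessenbergFunction (n + 1)) {s : ℕ}
    (hs : s ≤ h.p + 1) : Function.Injective (h.chain h.mulX s) := by
  induction s with
  | zero => exact Function.injective_id
  | succ s ih =>
    have hs' : s < h.p + 1 := hs
    lift s to Fin (n + 1) using hs'.trans_le h.p.isLt
    rw [chain, LinearMap.coe_comp]
    exact (ih hs'.le).comp (h.mulX_injective (Fin.le_def.2 (Nat.le_of_lt_succ hs')))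

end HessenbergFunction

theorem theorem3 (n : ℕ) (h : HessenbergFunction (n + 1)) :
    ∃ μ : ∀ s : ℕ, h.A (s + 1) →ₗ[MvPolynomial (Fin (n + 1)) ℚ] h.A s,
      -- multiplication by `x_s` is well defined and injective
      (∀ s : Fin (n + 1), s ≤ h.p →
        (∀ f : MvPolynomial (Fin (n + 1)) ℚ,
          μ s (h.mkA (s + 1) f) = h.mkA s (MvPolynomial.X s * f)) ∧
        Function.Injective (μ s)) ∧
      -- the resulting filtration of `R / I_h`, whose `s`-th step is a copy of `h.A s`
      h.idealA 0 = h.idealI ∧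
      (∀ s : ℕ, s ≤ (h.p : ℕ) → Function.Injective (h.chain μ s)) ∧
      LinearMap.range (h.chain μ 0) = ⊤ ∧
      (∀ s : ℕ, s ≤ (h.p : ℕ) →
        LinearMap.range (h.chain μ (s + 1)) ≤ LinearMap.range (h.chain μ s)) ∧
      LinearMap.range (h.chain μ ((h.p : ℕ) + 1)) = ⊥ ∧
      -- the successive quotients, as rings
      (∀ s : Fin (n + 1), s ≤ h.p →
        ∃ J : Ideal (h.A s),
          (J : Set (h.A s)) = Set.range (μ s) ∧
          J = Ideal.span {h.mkA s (MvPolynomial.X s)} ∧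
          ∃ e : (h.A s ⧸ J) ≃ₐ[ℚ] (h.remove s).A (h.r s),
            e (Ideal.Quotient.mk J (h.mkA s (MvPolynomial.X s))) = 0 ∧
            ∀ m : Fin n,
              e (Ideal.Quotient.mk J (h.mkA s (MvPolynomial.X (s.succAbove m)))) =
                (h.remove s).mkA (h.r s) (MvPolynomial.X m)) ∧
      -- the last step of the filtration
      ∃ e : h.A h.p ≃ₐ[ℚ] (h.remove h.p).A (h.r h.p),
        e (h.mkA h.p (MvPolynomial.X h.p)) = 0 ∧
        ∀ m : Fin n,
          e (h.mkA h.p (MvPolynomial.X (h.p.succAbove m))) =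
            (h.remove h.p).mkA (h.r h.p) (MvPolynomial.X m) := by
  have hp : LinearMap.range (h.chain h.mulX (h.p + 1)) = ⊥ := by
    have : Subsingleton (h.A (h.p + 1)) := Ideal.Quotient.subsingleton_iff.2 h.idealA_p_succ
    exact LinearMap.range_eq_bot.2 (Subsingleton.elim _ _)
  refine ⟨h.mulX, fun s hs => ⟨h.mulX_mkA s, h.mulX_injective hs⟩, rfl,
    fun s hs => h.chain_mulX_injective (hs.trans (Nat.le_succ _)), LinearMap.range_id,
    fun s _ => LinearMap.range_comp_le_range _ _, hp, fun s _ => ?_, ?_⟩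
  · obtain ⟨e, he⟩ := h.exists_quotient_equiv s
    exact ⟨_, (h.range_mulX s).symm, rfl, e, by simp, fun m => by simp [he]⟩
  · -- At `s = p(h)` the variable `x_s` is already zero, because `h.A (s + 1) = 0`.
    have hX : Ideal.span {h.mkA h.p (MvPolynomial.X h.p)} = ⊥ := by
      rw [Ideal.span_singleton_eq_bot, Ideal.Quotient.eq_zero_iff_mem,
        ← mul_one (MvPolynomial.X h.p)]
      refine h.X_mul_mem h.p ?_
      rw [h.idealA_p_succ]
      trivial
    obtain ⟨e, he⟩ := h.exists_quotient_equiv h.p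
    have he' : ∀ f, ((AlgEquiv.quotientBot ℚ (h.A h.p)).symm.trans
        ((Ideal.quotientEquivAlgOfEq ℚ hX.symm).trans e)) (h.mkA h.p f) =
          (h.remove h.p).mkA (h.r h.p) (HessenbergFunction.killVar h.p f) := he
    exact ⟨_, by rw [he', HessenbergFunction.killVar_X_self, map_zero],
      fun m => by rw [he', HessenbergFunction.killVar_X_succAbove]⟩
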